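/- Let $n\ge 1$ and let $\mathbb{B}^n=\{z\in\mathbb{C}^n:\|z\|<1\}$ be the Euclidean unit ball. For $z\in\mathbb{B}^n$ let $d(z)$ be the Euclidean distance from $z$ to $\partial\mathbb{B}^n$, and let $dV_N$ be Lebesgue volume measure on $\mathbb{B}^n$ normalized to total mass $1$. With $z_k=x_k+iy_k$ write $f_{z_k}=\frac12(\partial f/\partial x_k-i\,\partial f/\partial y_k)$, $f_{\overline z_k}=\frac12(\partial f/\partial x_k+i\,\partial f/\partial y_k)$, $$\|D_f\|=\Big(\sum_{k=1}^n|f_{z_k}|^2+\sum_{k=1}^n|f_{\overline z_k}|^2\Big)^{1/2},\qquad \Delta=\sum_{k=1}^n\Big(\frac{\partial^2}{\partial x_k^2}+\frac{\partial^2}{\partial y_k^2}\Big)=4\sum_{k=1}^n\frac{\partial^2}{\partial z_k\partial\overline z_k}.$$ Let $2\le\alpha\le 2n$, $\gamma>0$, $M\ge 0$, and put $q=\frac{2n+\gamma}{\alpha}-1$. Let $f:\mathbb{B}^n\to\mathbb{C}$ be three times continuously differentiable and let $a,b,c:\mathbb{B}^n\to[0,\infty)$ be continuous functions. Suppose that 1.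 (Heinz's inequality) $|\Delta f(z)|\le a(z)\|D_f(z)\|+b(z)|f(z)|+c(z)$ for all $z\in\mathbb{B}^n$, where $\sup_{\mathbb{B}^n}a<\infty$, $\sup_{\mathbb{B}^n}b<\infty$ and $c(z)\le M\,d(z)^{-q}$ for all $z\in\mathbb{B}^n$; 2. ($f\in\mathcal{D}_{\gamma,\alpha}(\mathbb{B}^n)$) $|f(0)|+\Big(\int_{\mathbb{B}^n}d(z)^{\gamma}\|D_f(z)\|^{\alpha}\,dV_N(z)\Big)^{1/\alpha}<\infty$; 3. $\operatorname{Re}(f\,\overline{\Delta f})\ge 0$ in $\mathbb{B}^n$; 4. $\operatorname{Re}\sum_{k=1}^n\big[\overline{f_{z_k}}\,(\Delta f)_{z_k}+\overline{f_{\overline z_k}}\,(\Delta f)_{\overline z_k}\big]\ge 0$ in $\mathbb{B}^n$. Then for every real $p\ge 2$ the function $z\mapsto d(z)^{pq}\,\Delta(|f|^p)(z)$ is integrable on $\mathbb{B}^n$ with respect to $dV_N$; that is, $$\int_{\mathbb{B}^n}d(z)^{pq}\,\Delta\big(|f(z)|^p\big)\,dV_N(z)<\infty .$$ -/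

import Mathlib

open MeasureTheory Metric
open scoped ENNReal ComplexConjugate Laplacian

noncomputable section

namespace HeinzDirichlet

/-- Complex Euclidean `n`-space with `‖z‖ = (∑ |z_k|²)^{1/2}`. -/
abbrev Cn (n : ℕ) : Type := EuclideanSpace ℂ (Fin n)

/-- The open unit ball of `ℂⁿ`. -/
abbrev unitBall (n : ℕ) : Set (Cn n) := ball (0 : Cn n) 1

/-- Euclidean distance from `z` to the boundary of the unit ball. -/
def bdist {n : ℕ} (z : Cn n) : ℝ := infDist z (frontier (unitBall n))

/-- Lebesgue volume measure on the unit ball, normalized to total mass one. -/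
def normVol (n : ℕ) : Measure (Cn n) :=
  (volume (unitBall n))⁻¹ • (volume : Measure (Cn n)).restrict (unitBall n)

/-- `∂f/∂x_k`, where `z_k = x_k + i y_k`. -/
def partialX {n : ℕ} (k : Fin n) (f : Cn n → ℂ) (z : Cn n) : ℂ :=
  fderiv ℝ f z (EuclideanSpace.single k (1 : ℂ))

/-- `∂f/∂y_k`, where `z_k = x_k + i y_k`. -/
def partialY {n : ℕ} (k : Fin n) (f : Cn n → ℂ) (z : Cn n) : ℂ :=
  fderiv ℝ f z (EuclideanSpace.single k Complex.I)

/-- `f_{z_k} = (1/2) (∂f/∂x_k - i ∂f/∂y_k)`. -/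
def dz {n : ℕ} (k : Fin n) (f : Cn n → ℂ) (z : Cn n) : ℂ :=
  (1 / 2 : ℂ) * (partialX k f z - Complex.I * partialY k f z)

/-- `f_{z̄_k} = (1/2) (∂f/∂x_k + i ∂f/∂y_k)`. -/
def dzbar {n : ℕ} (k : Fin n) (f : Cn n → ℂ) (z : Cn n) : ℂ :=
  (1 / 2 : ℂ) * (partialX k f z + Complex.I * partialY k f z)

/-- `‖D_f(z)‖ = (∑_k |f_{z_k}|² + ∑_k |f_{z̄_k}|²)^{1/2}`. -/
def normD {n : ℕ} (f : Cn n → ℂ) (z : Cn n) : ℝ :=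
  Real.sqrt (∑ k, ‖dz k f z‖ ^ 2 + ∑ k, ‖dzbar k f z‖ ^ 2)

/-- The energy integral `∫ d(z)^ν |f(z)|^μ ‖D_f(z)‖^t dV_N(z)`, as a value in `[0, ∞]`. -/
def dirichletEnergy {n : ℕ} (f : Cn n → ℂ) (ν μ t : ℝ) : ℝ≥0∞ :=
  ∫⁻ z, ENNReal.ofReal (bdist z ^ ν * ‖f z‖ ^ μ * normD f z ^ t) ∂(normVol n)

/-- `‖f‖_{D_{ν,t}} = |f(0)| + (∫ d(z)^ν ‖D_f(z)‖^t dV_N(z))^{1/t}`, as a value in `[0, ∞]`. -/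
def dirichletNorm {n : ℕ} (ν t : ℝ) (f : Cn n → ℂ) : ℝ≥0∞ :=
  ‖f 0‖ₑ + dirichletEnergy f ν 0 t ^ (1 / t)

/-- Membership in the Dirichlet-type space `D_{ν,t}` of the unit ball (for `ν ≥ 0`, `t > 0`). -/
def MemDirichlet {n : ℕ} (ν t : ℝ) (f : Cn n → ℂ) : Prop :=
  ContDiffOn ℝ 1 f (unitBall n) ∧ dirichletNorm ν t f < ∞

/-- `f` is of class `C^m` in the unit ball and satisfies Heinz's differential inequality
`|Δf| ≤ a ‖D_f‖ + b |f| + c` there, with nonnegative continuous coefficients `a`, `b`, `c`. -/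
structure MemHeinzWith {n : ℕ} (m : ℕ) (a b c : Cn n → ℝ) (f : Cn n → ℂ) : Prop where
  contDiffOn : ContDiffOn ℝ m f (unitBall n)
  continuousOn_a : ContinuousOn a (unitBall n)
  continuousOn_b : ContinuousOn b (unitBall n)
  continuousOn_c : ContinuousOn c (unitBall n)
  nonneg_a : ∀ z ∈ unitBall n, 0 ≤ a z
  nonneg_b : ∀ z ∈ unitBall n, 0 ≤ b z
  nonneg_c : ∀ z ∈ unitBall n, 0 ≤ c z
  heinz : ∀ z ∈ unitBall n, ‖(Δ f) z‖ ≤ a z * normD f z + b z * ‖f z‖ + c z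

end HeinzDirichlet

end

/-! Condition 4 and Bochner's formula make `|∇f|²` subharmonic. Its sub-mean value inequality on a
ball of radius comparable to `d(z)`, combined with Young's inequality and the finite Dirichlet
integral, gives `‖D_f‖ ≤ C d^(-(q+1))`; the exponent comes from `(q+1)α = 2n+γ` (`exists_normD_le`).
Since `q > 0`, integration along radii gives `|f| ≤ C' d^(-q)` (`exists_norm_le_of_normD_le`).

On the other side, `|Δ|f|^p|` is at most `p((p-1)|f|^(p-2)|∇f|² + |f|^(p-1)|Δf|)`
(`abs_laplacian_norm_rpow_le`). After multiplication by `d^(pq)`, the growth of `f` absorbs the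
powers of `|f|`, and Heinz's inequality leaves a constant plus a multiple of `(d^q ‖D_f‖)²`
(`rpow_mul_abs_laplacian_le`). Finally `α ≤ 2n` means `γ/α ≤ q`, so with `α ≥ 2` this square is at
most `1 + d^γ ‖D_f‖^α`, which is integrable. -/

namespace HeinzDirichlet

open Filter Topology
open scoped RealInnerProductSpace

/-! ### Sub-mean value inequality with a radial weight. -/

section SubMeanValue

/-- The square of the positive part is continuously differentiable. -/
lemma hasDerivAt_sq_posPart (s : ℝ) :
    HasDerivAt (fun x : ℝ => max 0 x ^ 2) (2 * max 0 s) s := by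
  rcases lt_trichotomy s 0 with h | rfl | h
  · rw [max_eq_left h.le, mul_zero]
    refine (hasDerivAt_const s (0 : ℝ)).congr_of_eventuallyEq ?_
    filter_upwards [Iio_mem_nhds h] with x hx
    simp [max_eq_left (show x ≤ 0 from le_of_lt hx)]
  · rw [max_self, mul_zero, hasDerivAt_iff_isLittleO]
    have h1 : (fun x : ℝ => x ^ 2) =o[𝓝 0] fun x : ℝ => x :=
      Asymptotics.isLittleO_pow_id one_lt_two
    simp only [max_self, ne_eq, OfNat.ofNat_ne_zero, not_false_eq_true, zero_pow, sub_zero,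
      smul_eq_mul, mul_zero]
    -- Near `0` the squared positive part is dominated by `x²`, which is `o(x)`.
    refine Asymptotics.IsBigO.trans_isLittleO ?_ h1
    refine Asymptotics.IsBigO.of_bound 1 (Eventually.of_forall fun x => ?_)
    rw [one_mul, norm_pow, norm_pow]
    gcongr
    rcases le_total x 0 with hx | hx
    · simp [max_eq_left hx]
    · simp [max_eq_right hx]
  · rw [max_eq_right h.le]
    have h2 : HasDerivAt (fun x : ℝ => x ^ 2) (2 * s) s := by simpa using hasDerivAt_pow 2 s
    refine h2.congr_of_eventuallyEq ?_
    filter_upwards [Ioi_mem_nhds h] with x hx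
    rw [max_eq_right (show 0 ≤ x from le_of_lt hx)]

variable {E : Type*} [NormedAddCommGroup E]

/-- The radial weight `4 (1 - |y|²)₊`. -/
def radialWeight (y : E) : ℝ := 4 * max 0 (1 - ‖y‖ ^ 2)

/-- The radial potential `((1 - |y|²)₊)²`, whose gradient at `y` is `-radialWeight y • y`. -/
def radialPotential (y : E) : ℝ := max 0 (1 - ‖y‖ ^ 2) ^ 2

lemma continuous_radialWeight : Continuous (radialWeight : E → ℝ) := by
  unfold radialWeight; fun_prop

lemma continuous_radialPotential : Continuous (radialPotential : E → ℝ) := by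
  unfold radialPotential; fun_prop

lemma radialWeight_nonneg (y : E) : 0 ≤ radialWeight y := by
  unfold radialWeight; positivity

lemma radialPotential_nonneg (y : E) : 0 ≤ radialPotential y := by
  unfold radialPotential; positivity

lemma radialWeight_le (y : E) : radialWeight y ≤ 4 := by
  have : max 0 (1 - ‖y‖ ^ 2) ≤ 1 := max_le zero_le_one (by nlinarith [sq_nonneg ‖y‖])
  unfold radialWeight; linarith

lemma radialWeight_eq_zero {y : E} (hy : 1 ≤ ‖y‖) : radialWeight y = 0 := by
  unfold radialWeight
  rw [max_eq_left (by nlinarith), mul_zero]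

lemma radialPotential_eq_zero {y : E} (hy : 1 ≤ ‖y‖) : radialPotential y = 0 := by
  unfold radialPotential
  rw [max_eq_left (by nlinarith)]; simp

variable [InnerProductSpace ℝ E]

lemma hasFDerivAt_radialPotential (y : E) :
    HasFDerivAt radialPotential (-(radialWeight y) • innerSL ℝ y) y := by
  have h1 : HasFDerivAt (fun y : E => 1 - ‖y‖ ^ 2) (-(2 • innerSL ℝ y)) y := by
    simpa using (hasStrictFDerivAt_norm_sq y).hasFDerivAt.const_sub 1
  have h2 := (hasDerivAt_sq_posPart (1 - ‖y‖ ^ 2)).comp_hasFDerivAt y h1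
  refine h2.congr_fderiv ?_
  ext w
  simp [radialWeight]
  ring

variable [FiniteDimensional ℝ E]

lemma hasCompactSupport_radialWeight : HasCompactSupport (radialWeight : E → ℝ) :=
  HasCompactSupport.intro (isCompact_closedBall (0 : E) 1) fun x hx =>
    radialWeight_eq_zero (by simp at hx; exact hx.le)

lemma hasCompactSupport_radialPotential : HasCompactSupport (radialPotential : E → ℝ) :=
  HasCompactSupport.intro (isCompact_closedBall (0 : E) 1) fun x hx =>
    radialPotential_eq_zero (by simp at hx; exact hx.le)

variable [MeasurableSpace E] [BorelSpace E] {ι : Type*} [Fintype ι]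

lemma integral_radialWeight_pos [Nontrivial E] : 0 < ∫ y : E, radialWeight y := by
  refine (continuous_radialWeight.integral_pos_of_hasCompactSupport_nonneg_nonzero
    hasCompactSupport_radialWeight radialWeight_nonneg (x := 0) ?_)
  simp [radialWeight]

/-- Divergence identity behind the monotonicity of radial means. -/
lemma integral_fderiv_mul_radialWeight (b : OrthonormalBasis ι ℝ E) {v : E → ℝ}
    (hv : ContDiff ℝ 2 v) (z : E) (t : ℝ) :
    ∫ y, fderiv ℝ v (z + t • y) y * radialWeight y
      = t * ∫ y, (∑ i, fderiv ℝ (fun x => fderiv ℝ v x (b i)) (z + t • y) (b i))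
          * radialPotential y := by
  have hd : ∀ i, ContDiff ℝ 1 fun x => fderiv ℝ v x (b i) := fun i =>
    (hv.fderiv_right (m := 1) (by norm_num)).clm_apply contDiff_const
  have hc : ∀ i, Continuous fun y : E => fderiv ℝ v (z + t • y) (b i) := fun i =>
    (hd i).continuous.comp (by fun_prop)
  have hc2 : ∀ i, Continuous fun y : E =>
      fderiv ℝ (fun x => fderiv ℝ v x (b i)) (z + t • y) (b i) := fun i =>
    (((hd i).continuous_fderiv one_ne_zero).clm_apply continuous_const).comp (by fun_prop)
  have hΨ' : ∀ (i : ι) (y : E), fderiv ℝ radialPotential y (b i)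
      = -(radialWeight y * inner ℝ y (b i)) := fun i y => by
    rw [(hasFDerivAt_radialPotential y).fderiv]; simp
  have hΨ'c : ∀ i : ι, Continuous fun y : E => fderiv ℝ radialPotential y (b i) := fun i => by
    simp_rw [hΨ']
    exact (continuous_radialWeight.mul (continuous_id.inner continuous_const)).neg
  have hg : ∀ (i : ι) (y : E), HasFDerivAt (fun y => fderiv ℝ v (z + t • y) (b i))
      (t • fderiv ℝ (fun x => fderiv ℝ v x (b i)) (z + t • y)) y := fun i y => by
    have h1 : HasFDerivAt (fun y : E => z + t • y) (t • ContinuousLinearMap.id ℝ E) y :=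
      ((hasFDerivAt_id y).const_smul t).const_add z
    have h2 := (((hd i).differentiable one_ne_zero) (z + t • y)).hasFDerivAt.comp y h1
    refine h2.congr_fderiv ?_
    ext w; simp
  -- Integration by parts: the compactly supported potential leaves no boundary term, and the chain
  -- rule for `y ↦ z + t • y` produces the factor `t`.
  have hparts : ∀ i, ∫ y, fderiv ℝ v (z + t • y) (b i) * fderiv ℝ radialPotential y (b i)
      = -(t * ∫ y, fderiv ℝ (fun x => fderiv ℝ v x (b i)) (z + t • y) (b i)
          * radialPotential y) := fun i => by
    rw [integral_mul_fderiv_eq_neg_fderiv_mul_of_integrable, ← integral_const_mul]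
    · congr 1
      refine integral_congr_ae (Eventually.of_forall fun y => ?_)
      simp only [(hg i y).fderiv, _root_.smul_apply, smul_eq_mul, mul_assoc]
    · simp_rw [(hg i _).fderiv, _root_.smul_apply]
      exact (((hc2 i).const_smul t).mul continuous_radialPotential).integrable_of_hasCompactSupport
        hasCompactSupport_radialPotential.mul_left
    · exact ((hc i).mul (hΨ'c i)).integrable_of_hasCompactSupport
        ((hasCompactSupport_radialPotential.fderiv_apply (𝕜 := ℝ) (b i)).mul_left)
    · exact ((hc i).mul continuous_radialPotential).integrable_of_hasCompactSupport
        hasCompactSupport_radialPotential.mul_left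
    · exact fun y _ => (hg i y).differentiableAt
    · exact fun y _ => (hasFDerivAt_radialPotential y).differentiableAt
  -- Since `radialWeight y • y` is minus the gradient of the potential, expanding `y` in the basis
  -- turns the radial derivative into a sum fit for integration by parts.
  have hpt : ∀ y : E, fderiv ℝ v (z + t • y) y * radialWeight y
      = ∑ i, -(fderiv ℝ v (z + t • y) (b i) * fderiv ℝ radialPotential y (b i)) := fun y => by
    conv_lhs => rw [← b.sum_repr' y, map_sum, Finset.sum_mul]
    refine Finset.sum_congr rfl fun i _ => ?_
    rw [hΨ', map_smul, smul_eq_mul, b.sum_repr' y, real_inner_comm]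
    ring
  have hint : ∀ i, Integrable fun y : E =>
      fderiv ℝ v (z + t • y) (b i) * fderiv ℝ radialPotential y (b i) := fun i =>
    ((hc i).mul (hΨ'c i)).integrable_of_hasCompactSupport
        ((hasCompactSupport_radialPotential.fderiv_apply (𝕜 := ℝ) (b i)).mul_left)
  have hint2 : ∀ i, Integrable fun y : E =>
      fderiv ℝ (fun x => fderiv ℝ v x (b i)) (z + t • y) (b i) * radialPotential y := fun i =>
    ((hc2 i).mul continuous_radialPotential).integrable_of_hasCompactSupport
        hasCompactSupport_radialPotential.mul_left
  simp_rw [hpt, Finset.sum_mul]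
  rw [integral_finsetSum _ (fun i _ => (hint i).fun_neg), integral_finsetSum _ fun i _ => hint2 i,
    Finset.mul_sum]
  refine Finset.sum_congr rfl fun i _ => ?_
  rw [integral_neg, hparts, neg_neg]

/-- Compact support bounds `∇v` by some `C`, so `C ‖y‖ radialWeight y` dominates the derivative for
every `t` at once. -/
lemma hasDerivAt_radialMean {v : E → ℝ} (hv : ContDiff ℝ 1 v) (hvs : HasCompactSupport v)
    (z : E) (t : ℝ) :
    HasDerivAt (fun t : ℝ => ∫ y, v (z + t • y) * radialWeight y)
      (∫ y, fderiv ℝ v (z + t • y) y * radialWeight y) t := by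
  obtain ⟨C, hC⟩ := (hvs.fderiv (𝕜 := ℝ)).exists_bound_of_continuous
    (hv.continuous_fderiv one_ne_zero)
  have hF : ∀ t : ℝ, Continuous fun y : E => v (z + t • y) * radialWeight y := fun t =>
    (hv.continuous.comp (by fun_prop)).mul continuous_radialWeight
  have hF' : ∀ t : ℝ, Continuous fun y : E => fderiv ℝ v (z + t • y) y * radialWeight y :=
    fun t => (((hv.continuous_fderiv one_ne_zero).comp (by fun_prop)).clm_apply
      continuous_id).mul continuous_radialWeight
  refine (hasDerivAt_integral_of_dominated_loc_of_deriv_le (μ := volume)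
    (F := fun (t : ℝ) (y : E) => v (z + t • y) * radialWeight y)
    (F' := fun (t : ℝ) (y : E) => fderiv ℝ v (z + t • y) y * radialWeight y)
    (bound := fun y => C * ‖y‖ * radialWeight y) (s := Set.univ) univ_mem
    (Eventually.of_forall fun t => (hF t).aestronglyMeasurable)
    ((hF t).integrable_of_hasCompactSupport hasCompactSupport_radialWeight.mul_left)
    (hF' t).aestronglyMeasurable ?_ ?_ ?_).2
  · refine Eventually.of_forall fun y t _ => ?_
    rw [norm_mul, Real.norm_of_nonneg (radialWeight_nonneg y)]
    refine mul_le_mul_of_nonneg_right ?_ (radialWeight_nonneg y)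
    exact ((fderiv ℝ v (z + t • y)).le_opNorm y).trans (by gcongr; exact hC _)
  · exact ((continuous_const.mul continuous_norm).mul
      continuous_radialWeight).integrable_of_hasCompactSupport
        hasCompactSupport_radialWeight.mul_left
  · refine Eventually.of_forall fun y t _ => ?_
    have h1 : HasDerivAt (fun t : ℝ => z + t • y) y t := by
      simpa using ((hasDerivAt_id t).smul_const y).const_add z
    exact (((hv.differentiable one_ne_zero) (z + t • y)).hasFDerivAt.comp_hasDerivAt t h1).mul_const
      _

/-- Weighted sub-mean value inequality for functions with nonnegative Laplacian. -/
lemma mul_integral_radialWeight_le (b : OrthonormalBasis ι ℝ E) {v : E → ℝ}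
    (hv : ContDiff ℝ 2 v) (hvs : HasCompactSupport v) {z : E} {r : ℝ} (hr : 0 < r)
    (hsub : ∀ x ∈ ball z r, 0 ≤ ∑ i, fderiv ℝ (fun x => fderiv ℝ v x (b i)) x (b i)) :
    v z * ∫ y : E, radialWeight y ≤ ∫ y, v (z + r • y) * radialWeight y := by
  have hder := hasDerivAt_radialMean (hv.of_le (by norm_num)) hvs z
  have hmono : MonotoneOn (fun t : ℝ => ∫ y, v (z + t • y) * radialWeight y) (Set.Icc 0 r) := by
    refine monotoneOn_of_deriv_nonneg (convex_Icc 0 r)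
      (fun t _ => (hder t).continuousAt.continuousWithinAt)
      (fun t _ => (hder t).differentiableAt.differentiableWithinAt) fun t ht => ?_
    rw [interior_Icc] at ht
    rw [(hder t).deriv, integral_fderiv_mul_radialWeight b hv]
    refine mul_nonneg ht.1.le (integral_nonneg fun y => ?_)
    rcases le_or_gt 1 ‖y‖ with hy | hy
    · simp [radialPotential_eq_zero hy]
    · refine mul_nonneg (hsub _ ?_) (radialPotential_nonneg y)
      rw [mem_ball, dist_self_add_left, norm_smul, Real.norm_of_nonneg ht.1.le]
      nlinarith [ht.1, ht.2, norm_nonneg y]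
  -- At `t = 0` the weighted mean is `v z` times the total mass of the weight.
  have := hmono (Set.left_mem_Icc.2 hr.le) (Set.right_mem_Icc.2 hr.le) hr.le
  simpa [integral_const_mul] using this

/-- Sub-mean value inequality on balls, up to a dimensional constant. -/
lemma mul_integral_radialWeight_le_setIntegral (b : OrthonormalBasis ι ℝ E) {v : E → ℝ}
    (hv : ContDiff ℝ 2 v) (hvs : HasCompactSupport v) (hv0 : ∀ x, 0 ≤ v x)
    {z : E} {r : ℝ} (hr : 0 < r)
    (hsub : ∀ x ∈ ball z r, 0 ≤ ∑ i, fderiv ℝ (fun x => fderiv ℝ v x (b i)) x (b i)) :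
    v z * ∫ y : E, radialWeight y
      ≤ 4 * (r ^ Module.finrank ℝ E)⁻¹ * ∫ x in ball z r, v x := by
  refine (mul_integral_radialWeight_le b hv hvs hr hsub).trans ?_
  -- The weight is at most `4` and vanishes off the unit ball; extending `v` by zero outside `ball z
  -- r` makes the change of variables global, with Jacobian `r ^ (-dim)`.
  set g : E → ℝ := (ball z r).indicator v with hg
  have hgi : Integrable g :=
    (hv.continuous.integrable_of_hasCompactSupport hvs).indicator measurableSet_ball
  have hle : ∀ y : E, v (z + r • y) * radialWeight y ≤ 4 * g (z + r • y) := fun y => by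
    rcases le_or_gt 1 ‖y‖ with hy | hy
    · rw [radialWeight_eq_zero hy, mul_zero]
      exact mul_nonneg (by norm_num) (Set.indicator_nonneg (fun x _ => hv0 x) _)
    · have : z + r • y ∈ ball z r := by
        rw [mem_ball, dist_self_add_left, norm_smul, Real.norm_of_nonneg hr.le]
        nlinarith
      rw [hg, Set.indicator_of_mem this, mul_comm]
      exact mul_le_mul_of_nonneg_right (radialWeight_le y) (hv0 _)
  have hgi' : Integrable fun y : E => g (z + r • y) :=
    (hgi.comp_add_left z).comp_smul hr.ne'
  calc ∫ y, v (z + r • y) * radialWeight y ≤ ∫ y, 4 * g (z + r • y) := by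
        refine integral_mono ?_ (hgi'.const_mul 4) hle
        exact ((hv.continuous.comp (by fun_prop)).mul
          continuous_radialWeight).integrable_of_hasCompactSupport
            hasCompactSupport_radialWeight.mul_left
    _ = 4 * (r ^ Module.finrank ℝ E)⁻¹ * ∫ x in ball z r, v x := by
        rw [integral_const_mul, Measure.integral_comp_smul volume (fun y => g (z + y)) r,
          integral_add_left_eq_self g z, hg, integral_indicator measurableSet_ball,
          abs_of_pos (by positivity), smul_eq_mul, mul_assoc]

end SubMeanValue

/-! ### Bochner's inequality and subharmonicity of the squared gradient. -/

section Gradient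

variable {E G : Type*} [NormedAddCommGroup E] [InnerProductSpace ℝ E]
  [NormedAddCommGroup G] [InnerProductSpace ℝ G]

/-- The derivative of `F` in the direction `e`. -/
noncomputable def dirDeriv (e : E) (F : E → G) (x : E) : G := fderiv ℝ F x e

lemma fderiv_dirDeriv {F : E → G} {x : E} (h : DifferentiableAt ℝ (fderiv ℝ F) x) (e w : E) :
    fderiv ℝ (dirDeriv e F) x w = fderiv ℝ (fderiv ℝ F) x w e := by
  unfold dirDeriv
  rw [fderiv_clm_apply h (differentiableAt_const e)]
  simp

lemma _root_.ContDiff.dirDeriv {F : E → G} {m k : ℕ} (hF : ContDiff ℝ k F) (e : E)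
    (hmk : m + 1 ≤ k) : ContDiff ℝ m (dirDeriv e F) :=
  (hF.fderiv_right (m := m) (by exact_mod_cast hmk)).clm_apply contDiff_const

lemma dirDeriv_comm {F : E → G} (hF : ContDiff ℝ 2 F) (a e : E) :
    dirDeriv a (dirDeriv e F) = dirDeriv e (dirDeriv a F) := by
  funext x
  have hd : DifferentiableAt ℝ (fderiv ℝ F) x :=
    (hF.fderiv_right (m := 1) (by norm_num)).differentiable one_ne_zero x
  have hs : IsSymmSndFDerivAt ℝ F x := hF.contDiffAt.isSymmSndFDerivAt (by simp)
  change fderiv ℝ (dirDeriv e F) x a = fderiv ℝ (dirDeriv a F) x e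
  rw [fderiv_dirDeriv hd, fderiv_dirDeriv hd, hs a e]

lemma dirDeriv_finsetSum {ι : Type*} (s : Finset ι) {F : ι → E → G} {x : E} (e : E)
    (hF : ∀ i ∈ s, DifferentiableAt ℝ (F i) x) :
    dirDeriv e (fun y => ∑ i ∈ s, F i y) x = ∑ i ∈ s, dirDeriv e (F i) x := by
  unfold dirDeriv
  rw [fderiv_fun_sum hF]
  simp

lemma dirDeriv_congr {F₁ F₂ : E → G} {x : E} (h : F₁ =ᶠ[𝓝 x] F₂) (e : E) :
    dirDeriv e F₁ x = dirDeriv e F₂ x := by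
  unfold dirDeriv; rw [h.fderiv_eq]

variable [FiniteDimensional ℝ E] {ι : Type*} [Fintype ι]

lemma laplacian_eq_sum_dirDeriv (b : OrthonormalBasis ι ℝ E) {F : E → G} {x : E}
    (h : DifferentiableAt ℝ (fderiv ℝ F) x) :
    (Δ F) x = ∑ i, dirDeriv (b i) (dirDeriv (b i) F) x := by
  rw [InnerProductSpace.laplacian_eq_iteratedFDeriv_orthonormalBasis F b]
  refine Finset.sum_congr rfl fun i _ => ?_
  rw [iteratedFDeriv_two_apply]
  exact (fderiv_dirDeriv h (b i) (b i)).symm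

/-- Two applications of the symmetry of second derivatives move `e` innermost; the inner swap is
differentiated once more, whence class `C³`. -/
lemma dirDeriv_laplacian (b : OrthonormalBasis ι ℝ E) {F : E → G} (hF : ContDiff ℝ 3 F) (e x : E) :
    dirDeriv e (Δ F) x = ∑ j, dirDeriv (b j) (dirDeriv (b j) (dirDeriv e F)) x := by
  have hΔ : (Δ F) = fun y => ∑ j, dirDeriv (b j) (dirDeriv (b j) F) y := funext fun y =>
    laplacian_eq_sum_dirDeriv b
      ((hF.fderiv_right (m := 1) (by norm_num)).differentiable one_ne_zero y)
  have h2 : ∀ a, ContDiff ℝ 2 (dirDeriv a F) := fun a => hF.dirDeriv (m := 2) a le_rfl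
  have h1 : ∀ a c, ContDiff ℝ 1 (dirDeriv a (dirDeriv c F)) := fun a c =>
    (h2 c).dirDeriv (m := 1) a le_rfl
  rw [hΔ, dirDeriv_finsetSum _ _ fun j _ => (h1 _ _).differentiable one_ne_zero x]
  refine Finset.sum_congr rfl fun j _ => ?_
  rw [dirDeriv_comm (h2 (b j)), dirDeriv_comm (hF.of_le (by norm_num)) e (b j)]

omit [FiniteDimensional ℝ E] in
lemma dirDeriv_inner_self {F : E → G} {x : E} (hF : DifferentiableAt ℝ F x) (e : E) :
    dirDeriv e (fun y => ‖F y‖ ^ 2) x = 2 * ⟪F x, dirDeriv e F x⟫ := by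
  unfold dirDeriv
  simp_rw [← real_inner_self_eq_norm_sq]
  rw [fderiv_inner_apply ℝ hF hF, real_inner_comm]
  ring

/-- The squared gradient norm of `F` with respect to an orthonormal basis. -/
noncomputable def gradSq (b : OrthonormalBasis ι ℝ E) (F : E → G) (x : E) : ℝ := ∑ i, ‖dirDeriv (b i) F x‖ ^ 2

omit [FiniteDimensional ℝ E] in
lemma _root_.ContDiff.gradSq (b : OrthonormalBasis ι ℝ E) {F : E → G} (hF : ContDiff ℝ 3 F) :
    ContDiff ℝ 2 (gradSq b F) :=
  ContDiff.sum fun i _ => (hF.dirDeriv (m := 2) (b i) le_rfl).norm_sq ℝ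

/-- Bochner's inequality `Δ|∇F|² ≥ 2⟪∇F, ∇ΔF⟫`. -/
lemma two_mul_inner_le_sum_dirDeriv_gradSq (b : OrthonormalBasis ι ℝ E) {F : E → G}
    (hF : ContDiff ℝ 3 F) (x : E) :
    2 * ∑ i, ⟪dirDeriv (b i) F x, dirDeriv (b i) (Δ F) x⟫
      ≤ ∑ j, dirDeriv (b j) (dirDeriv (b j) (gradSq b F)) x := by
  have h2 : ∀ a, ContDiff ℝ 2 (dirDeriv a F) := fun a => hF.dirDeriv (m := 2) a le_rfl
  have h1 : ∀ a c, ContDiff ℝ 1 (dirDeriv a (dirDeriv c F)) := fun a c =>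
    (h2 c).dirDeriv (m := 1) a le_rfl
  have hd2 : ∀ a, Differentiable ℝ (dirDeriv a F) := fun a => (h2 a).differentiable two_ne_zero
  have hd1 : ∀ a c, Differentiable ℝ (dirDeriv a (dirDeriv c F)) := fun a c =>
    (h1 a c).differentiable one_ne_zero
  have hfirst : ∀ e, dirDeriv e (gradSq b F)
      = fun y => ∑ i, 2 * ⟪dirDeriv (b i) F y, dirDeriv e (dirDeriv (b i) F) y⟫ := fun e => by
    funext y
    unfold gradSq
    rw [dirDeriv_finsetSum _ _ fun i _ => ((hd2 (b i)) y).norm_sq ℝ]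
    exact Finset.sum_congr rfl fun i _ => dirDeriv_inner_self (hd2 (b i) y) e
  have hsecond : ∀ e, dirDeriv e (dirDeriv e (gradSq b F)) x
      = ∑ i, 2 * (‖dirDeriv e (dirDeriv (b i) F) x‖ ^ 2
        + ⟪dirDeriv (b i) F x, dirDeriv e (dirDeriv e (dirDeriv (b i) F)) x⟫) := fun e => by
    rw [hfirst, dirDeriv_finsetSum _ _ fun i _ =>
      (((hd2 (b i)) x).inner ℝ ((hd1 e (b i)) x)).const_mul 2]
    refine Finset.sum_congr rfl fun i _ => ?_
    change fderiv ℝ _ x e = _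
    rw [fderiv_const_mul (((hd2 (b i)) x).inner ℝ ((hd1 e (b i)) x)), _root_.smul_apply,
      fderiv_inner_apply ℝ (hd2 (b i) x) (hd1 e (b i) x), smul_eq_mul,
      ← real_inner_self_eq_norm_sq, add_comm]
    rfl
  simp_rw [hsecond]
  rw [Finset.sum_comm, Finset.mul_sum]
  refine Finset.sum_le_sum fun i _ => ?_
  rw [dirDeriv_laplacian b hF, inner_sum, ← Finset.mul_sum]
  gcongr with j
  -- The inequality comes from dropping the squared Hessian.
  have := sq_nonneg ‖dirDeriv (b j) (dirDeriv (b i) F) x‖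
  linarith

omit [FiniteDimensional ℝ E] in
/-- The derivative in an arbitrary direction is controlled by the gradient norm. -/
lemma norm_fderiv_apply_le (b : OrthonormalBasis ι ℝ E) (F : E → G) (x w : E) :
    ‖fderiv ℝ F x w‖ ≤ √(gradSq b F x) * ‖w‖ := by
  conv_lhs => rw [← b.sum_repr' w, map_sum]
  calc ‖∑ i, fderiv ℝ F x (⟪b i, w⟫ • b i)‖
      ≤ ∑ i, ‖dirDeriv (b i) F x‖ * ‖⟪b i, w⟫‖ := by
        refine (norm_sum_le _ _).trans (Finset.sum_le_sum fun i _ => ?_)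
        rw [map_smul, norm_smul, mul_comm]; rfl
    _ ≤ √(∑ i, ‖dirDeriv (b i) F x‖ ^ 2) * √(∑ i, ‖⟪b i, w⟫‖ ^ 2) :=
        Real.sum_mul_le_sqrt_mul_sqrt _ _ _
    _ = √(gradSq b F x) * ‖w‖ := by
        rw [b.sum_sq_norm_inner_right, Real.sqrt_sq (norm_nonneg w)]; rfl

variable [MeasurableSpace E] [BorelSpace E]

/-- If `⟪∇f, ∇Δf⟫ ≥ 0` near a ball, then `|∇f|²` satisfies the sub-mean value inequality there. -/
lemma gradSq_mul_integral_le (b : OrthonormalBasis ι ℝ E) {f : E → G} {U : Set E} (hU : IsOpen U)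
    (hf : ContDiffOn ℝ 3 f U)
    (hgrad : ∀ x ∈ U, 0 ≤ ∑ i, ⟪dirDeriv (b i) f x, dirDeriv (b i) (Δ f) x⟫)
    {z : E} {r R : ℝ} (hr : 0 < r) (hrR : r < R) (hR : closedBall z R ⊆ U) :
    gradSq b f z * ∫ y : E, radialWeight y
      ≤ 4 * (r ^ Module.finrank ℝ E)⁻¹ * ∫ x in ball z r, gradSq b f x := by
  -- The sub-mean value inequality needs a global, compactly supported function. The cutoff equals
  -- `1` on `ball z r`, so all derivatives of `F` and `f` agree there.
  let χ : ContDiffBump z := ⟨r, R, hr, hrR⟩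
  set F : E → G := fun x => χ x • f x with hFdef
  have hF : ContDiff ℝ 3 F := by
    rw [contDiff_iff_contDiffAt]
    intro x
    by_cases hx : x ∈ U
    · exact χ.contDiff.contDiffAt.smul (hf.contDiffAt (hU.mem_nhds hx))
    · have hx' : x ∈ (closedBall z R)ᶜ := fun h => hx (hR h)
      refine (contDiffAt_const (c := (0 : G))).congr_of_eventuallyEq ?_
      filter_upwards [isClosed_closedBall.isOpen_compl.mem_nhds hx'] with y hy
      have : χ y = 0 := χ.zero_of_le_dist (by simpa using (le_of_lt (by simpa using hy)))
      simp [hFdef, this]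
  have hFs : HasCompactSupport F := χ.hasCompactSupport.smul_right
  have hFf : ∀ x ∈ ball z r, F =ᶠ[𝓝 x] f := fun x hx => by
    filter_upwards [isOpen_ball.mem_nhds hx] with y hy
    have : χ y = 1 := χ.one_of_mem_closedBall (ball_subset_closedBall hy)
    simp [hFdef, this]
  have hgs : ∀ x ∈ ball z r, gradSq b F x = gradSq b f x := fun x hx =>
    Finset.sum_congr rfl fun i _ => by rw [dirDeriv_congr (hFf x hx)]
  have hV := hF.gradSq b
  have hVs : HasCompactSupport (gradSq b F) := by
    refine (hFs.fderiv (𝕜 := ℝ)).mono fun x hx => ?_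
    contrapose! hx
    rw [Function.notMem_support] at hx ⊢
    simp [gradSq, dirDeriv, hx]
  have hsub : ∀ x ∈ ball z r, 0 ≤ ∑ i, dirDeriv (b i) (dirDeriv (b i) (gradSq b F)) x := by
    intro x hx
    refine le_trans (mul_nonneg zero_le_two ?_) (two_mul_inner_le_sum_dirDeriv_gradSq b hF x)
    refine le_of_le_of_eq (hgrad x (hR (ball_subset_closedBall (ball_subset_ball hrR.le hx))))
      (Finset.sum_congr rfl fun i _ => ?_)
    rw [dirDeriv_congr (hFf x hx),
      dirDeriv_congr (InnerProductSpace.laplacian_congr_nhds (hFf x hx))]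
  have := mul_integral_radialWeight_le_setIntegral b hV hVs
    (fun x => Finset.sum_nonneg fun i _ => by positivity) hr hsub
  rwa [hgs z (mem_ball_self hr), setIntegral_congr_fun measurableSet_ball hgs] at this

end Gradient

/-! ### Wirtinger derivatives in real coordinates. -/

section Coordinates

variable {n : ℕ}

/-- The real orthonormal basis `e₁, i e₁, …, e_n, i e_n` of `ℂⁿ`. -/
noncomputable def realBasis (n : ℕ) : OrthonormalBasis ((_ : Fin n) × Fin 2) ℝ (Cn n) :=
  Pi.orthonormalBasis fun _ => Complex.orthonormalBasisOneI

lemma sum_realBasis {M : Type*} [AddCommMonoid M] (g : Cn n → M) :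
    ∑ i, g (realBasis n i)
      = ∑ k, (g (EuclideanSpace.single k 1) + g (EuclideanSpace.single k Complex.I)) := by
  rw [Fintype.sum_sigma]
  refine Finset.sum_congr rfl fun k _ => ?_
  rw [Fin.sum_univ_two]
  simp [realBasis]

/-- In each coordinate the mixed `x`-`y` terms of the two pairings cancel, while the pure terms add
up to `1/4 + 1/4`. This turns condition 4 into the real hypothesis of Bochner's argument. -/
lemma gradient_pairing (f g : Cn n → ℂ) (z : Cn n) :
    (∑ k, (conj (dz k f z) * dz k g z + conj (dzbar k f z) * dzbar k g z)).re
      = 1 / 2 * ∑ i, ⟪dirDeriv (realBasis n i) f z, dirDeriv (realBasis n i) g z⟫ := by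
  rw [sum_realBasis fun e => ⟪dirDeriv e f z, dirDeriv e g z⟫, Complex.re_sum, Finset.mul_sum]
  refine Finset.sum_congr rfl fun k _ => ?_
  simp only [Complex.inner]
  change _ = 1 / 2 * ((partialX k g z * conj (partialX k f z)).re
    + (partialY k g z * conj (partialY k f z)).re)
  simp only [dz, dzbar]
  generalize partialX k f z = a
  generalize partialX k g z = a'
  generalize partialY k f z = d
  generalize partialY k g z = d'
  simp
  ring

lemma normD_sq (f : Cn n → ℂ) (z : Cn n) :
    normD f z ^ 2 = 1 / 2 * gradSq (realBasis n) f z := by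
  have h := gradient_pairing f f z
  simp only [real_inner_self_eq_norm_sq] at h
  rw [normD, Real.sq_sqrt (by positivity), gradSq, ← h, ← Finset.sum_add_distrib, Complex.re_sum]
  refine Finset.sum_congr rfl fun k _ => ?_
  rw [← Complex.normSq_eq_conj_mul_self, ← Complex.normSq_eq_conj_mul_self,
    Complex.normSq_eq_norm_sq, Complex.normSq_eq_norm_sq, ← Complex.ofReal_add, Complex.ofReal_re]

end Coordinates

/-! ### The Laplacian of a power of the norm. -/

section NormPower

variable {E G : Type*} [NormedAddCommGroup E] [InnerProductSpace ℝ E]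
  [NormedAddCommGroup G] [InnerProductSpace ℝ G]

/-- The map `w ↦ |w|^s w` is differentiable, with derivative of size at most `(s + 1) |w|^s`. -/
lemma exists_hasFDerivAt_norm_rpow_smul {s : ℝ} (hs : 0 ≤ s) (w : G) :
    ∃ H' : G →L[ℝ] G, HasFDerivAt (fun x : G => ‖x‖ ^ s • x) H' w ∧
      ∀ v, ‖H' v‖ ≤ (s + 1) * ‖w‖ ^ s * ‖v‖ := by
  rcases eq_or_ne w 0 with rfl | hw
  · rcases hs.eq_or_lt with rfl | hs
    · exact ⟨ContinuousLinearMap.id ℝ G, by simpa [Function.id_def] using hasFDerivAt_id (𝕜 := ℝ) (0 : G),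
        by simp⟩
    · refine ⟨0, ?_, fun v => by simp; positivity⟩
      rw [hasFDerivAt_iff_isLittleO_nhds_zero]
      simp only [zero_add, norm_zero, smul_zero, sub_zero, zero_apply]
      -- For `s > 0` the scalar factor tends to `0`, so the derivative at the origin is zero.
      have h1 : (fun x : G => ‖x‖ ^ s) =o[𝓝 0] fun _ : G => (1 : ℝ) := by
        rw [Asymptotics.isLittleO_one_iff]
        have : Continuous fun x : G => ‖x‖ ^ s :=
          continuous_norm.rpow_const fun _ => Or.inr hs.le
        simpa [Real.zero_rpow hs.ne'] using this.tendsto 0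
      simpa using h1.smul_isBigO (Asymptotics.isBigO_refl (fun x : G => x) (𝓝 0))
  · have hw' : 0 < ‖w‖ := norm_pos_iff.2 hw
    have h1 : HasFDerivAt (fun x : G => ‖x‖ ^ s) ((s * ‖w‖ ^ (s - 2)) • innerSL ℝ w) w := by
      have h2 := (hasStrictFDerivAt_norm_sq w).hasFDerivAt.rpow_const (p := s / 2)
        (Or.inl (by positivity))
      have h3 : (fun x : G => (‖x‖ ^ 2) ^ (s / 2)) = fun x => ‖x‖ ^ s := by
        funext x
        rw [← Real.rpow_natCast, ← Real.rpow_mul (norm_nonneg x)]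
        congr 1; push_cast; ring
      rw [h3] at h2
      refine h2.congr_fderiv ?_
      ext v
      rw [← Real.rpow_natCast, ← Real.rpow_mul (norm_nonneg w),
        show ((2 : ℕ) : ℝ) * (s / 2 - 1) = s - 2 by push_cast; ring]
      simp
      ring
    refine ⟨_, h1.smul (hasFDerivAt_id w), fun v => ?_⟩
    have h4 : ‖w‖ ^ (s - 2) * ‖w‖ * ‖w‖ = ‖w‖ ^ s := by
      rw [mul_assoc, ← sq, ← Real.rpow_natCast, ← Real.rpow_add hw']
      congr 1; push_cast; ring
    have h5 := abs_real_inner_le_norm w v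
    simp only [_root_.add_apply, _root_.smul_apply, ContinuousLinearMap.id_apply,
      ContinuousLinearMap.smulRight_apply, innerSL_apply_apply, smul_eq_mul]
    refine (norm_add_le _ _).trans ?_
    rw [norm_smul, norm_smul, norm_mul, norm_mul, Real.norm_of_nonneg hs,
      Real.norm_of_nonneg (by positivity : 0 ≤ ‖w‖ ^ s),
      Real.norm_of_nonneg (by positivity : 0 ≤ ‖w‖ ^ (s - 2)), Real.norm_eq_abs]
    calc ‖w‖ ^ s * ‖v‖ + s * ‖w‖ ^ (s - 2) * |⟪w, v⟫| * ‖w‖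
        ≤ ‖w‖ ^ s * ‖v‖ + s * ‖w‖ ^ (s - 2) * (‖w‖ * ‖v‖) * ‖w‖ := by gcongr
      _ = ‖w‖ ^ s * ‖v‖ + s * (‖w‖ ^ (s - 2) * ‖w‖ * ‖w‖) * ‖v‖ := by ring
      _ = (s + 1) * ‖w‖ ^ s * ‖v‖ := by rw [h4]; ring

variable [FiniteDimensional ℝ E] {ι : Type*} [Fintype ι]

/-- Pointwise bound for the Laplacian of `|f|^p`. -/
lemma abs_laplacian_norm_rpow_le (b : OrthonormalBasis ι ℝ E) {f : E → G} {z : E}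
    (hf : ContDiffAt ℝ 2 f z) {p : ℝ} (hp : 2 ≤ p) :
    |(Δ fun w => ‖f w‖ ^ p) z|
      ≤ p * ((p - 1) * ‖f z‖ ^ (p - 2) * gradSq b f z
        + ‖f z‖ ^ (p - 2) * ‖f z‖ * ‖(Δ f) z‖) := by
  set u : E → ℝ := fun w => ‖f w‖ ^ p with hu
  set H : G → G := fun x => ‖x‖ ^ (p - 2) • x with hH
  obtain ⟨H', hH', hH'le⟩ := exists_hasFDerivAt_norm_rpow_smul (sub_nonneg.2 hp) (f z)
  have hfz : DifferentiableAt ℝ f z := hf.differentiableAt two_ne_zero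
  have hdf : DifferentiableAt ℝ (fderiv ℝ f) z :=
    (hf.fderiv_right (m := 1) (by norm_num)).differentiableAt one_ne_zero
  have hHf : HasFDerivAt (fun y => H (f y)) (H'.comp (fderiv ℝ f z)) z :=
    hH'.comp z hfz.hasFDerivAt
  -- This first-derivative formula also holds at zeros of `f`, as `p > 1`. It can be differentiated
  -- again there because `H` is differentiable everywhere for `p ≥ 2`.
  have hev : fderiv ℝ u =ᶠ[𝓝 z] fun y => p • (innerSL ℝ (H (f y))).comp (fderiv ℝ f y) := by
    filter_upwards [hf.eventually (by simp)] with y hy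
    have h1 := (hasFDerivAt_norm_rpow (f y) (by linarith : 1 < p)).comp y
      (hy.differentiableAt two_ne_zero).hasFDerivAt
    rw [show u = (fun x : G => ‖x‖ ^ p) ∘ f from rfl, h1.fderiv]
    ext v
    simp [hH, mul_assoc]
  have hdu : DifferentiableAt ℝ (fderiv ℝ u) z := by
    refine DifferentiableAt.congr_of_eventuallyEq ?_ hev
    refine (DifferentiableAt.clm_comp ?_ hdf).const_smul p
    exact (innerSL ℝ : G →L[ℝ] _).differentiableAt.comp z hHf.differentiableAt
  have hdd : ∀ e, DifferentiableAt ℝ (dirDeriv e f) z := fun e =>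
    hdf.clm_apply (differentiableAt_const e)
  have hsecond : ∀ e, dirDeriv e (dirDeriv e u) z
      = p * (⟪H (f z), dirDeriv e (dirDeriv e f) z⟫ + ⟪H' (dirDeriv e f z), dirDeriv e f z⟫) := by
    intro e
    have h1 : dirDeriv e u =ᶠ[𝓝 z] fun y => p * ⟪H (f y), dirDeriv e f y⟫ := by
      filter_upwards [hev] with y hy
      simp [dirDeriv, hy]
    rw [dirDeriv_congr h1]
    change fderiv ℝ _ z e = _
    rw [fderiv_const_mul (hHf.differentiableAt.inner ℝ (hdd e)), _root_.smul_apply,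
      fderiv_inner_apply ℝ hHf.differentiableAt (hdd e), hHf.fderiv, smul_eq_mul]
    rfl
  have hnH : ‖H (f z)‖ = ‖f z‖ ^ (p - 2) * ‖f z‖ := by
    rw [hH, norm_smul, Real.norm_of_nonneg (by positivity)]
  rw [laplacian_eq_sum_dirDeriv b hdu]
  simp_rw [hsecond]
  rw [← Finset.mul_sum, Finset.sum_add_distrib, ← inner_sum, ← laplacian_eq_sum_dirDeriv b hdf,
    abs_mul, abs_of_nonneg (by linarith : 0 ≤ p), add_comm]
  refine mul_le_mul_of_nonneg_left ((abs_add_le _ _).trans (add_le_add ?_ ?_)) (by linarith)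
  · rw [gradSq, Finset.mul_sum]
    refine (Finset.abs_sum_le_sum_abs _ _).trans (Finset.sum_le_sum fun i _ => ?_)
    refine (abs_real_inner_le_norm _ _).trans ?_
    rw [sq, ← mul_assoc]
    refine mul_le_mul_of_nonneg_right ((hH'le _).trans_eq ?_) (norm_nonneg _)
    ring
  · rw [← hnH]
    exact abs_real_inner_le_norm _ _

/-- The Laplacian of an arbitrary function is measurable. -/
lemma measurable_laplacian [MeasurableSpace E] [BorelSpace E]
    (u : E → ℝ) : Measurable (Δ u) := by
  rw [InnerProductSpace.laplacian_eq_iteratedFDeriv_stdOrthonormalBasis u]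
  refine Finset.measurable_sum _ fun i _ => ?_
  simp_rw [iteratedFDeriv_two_apply]
  -- Directional derivatives of any map into a complete space are measurable, so `u` needs no
  -- regularity.
  exact (ContinuousLinearMap.measurable_apply _).comp
    (measurable_fderiv_apply_const ℝ (fderiv ℝ u) _)

end NormPower

/-! ### Growth of the gradient and of the function. -/

section Growth

variable {n : ℕ}

/-- A nearest boundary point is `z/‖z‖`, or any unit vector when `z = 0`; such a vector exists
because `n > 0`. -/
lemma bdist_eq (hn : 0 < n) {z : Cn n} (hz : z ∈ unitBall n) : bdist z = 1 - ‖z‖ := by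
  have hz' : ‖z‖ < 1 := by simpa using hz
  have : Nonempty (Fin n) := ⟨⟨0, hn⟩⟩
  rw [bdist, unitBall, frontier_ball _ one_ne_zero]
  obtain ⟨e, he, hze⟩ : ∃ e : Cn n, ‖e‖ = 1 ∧ ‖z‖ • e = z := by
    rcases eq_or_ne z 0 with rfl | h
    · exact ⟨EuclideanSpace.single ⟨0, hn⟩ 1, by simp, by simp⟩
    · have := norm_ne_zero_iff.2 h
      refine ⟨‖z‖⁻¹ • z, ?_, by rw [smul_smul, mul_inv_cancel₀ this, one_smul]⟩
      rw [norm_smul, norm_inv, norm_norm, inv_mul_cancel₀ this]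
  have hes : e ∈ sphere (0 : Cn n) 1 := by simpa using he
  refine le_antisymm ?_ ?_
  · refine (infDist_le_dist_of_mem hes).trans_eq ?_
    rw [dist_comm, dist_eq_norm]
    conv_lhs => rw [← hze]
    rw [show e - ‖z‖ • e = (1 - ‖z‖) • e by rw [sub_smul, one_smul], norm_smul, he, mul_one,
      Real.norm_of_nonneg (by linarith)]
  · rw [le_infDist ⟨e, hes⟩]
    intro y hy
    have h1 : ‖y‖ = 1 := by simpa using hy
    rw [dist_comm, dist_eq_norm, ← h1]
    exact norm_sub_norm_le y z

lemma continuous_bdist : Continuous (bdist : Cn n → ℝ) := continuous_infDist_pt _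

lemma bdist_nonneg (z : Cn n) : 0 ≤ bdist z := infDist_nonneg

lemma normD_nonneg (f : Cn n → ℂ) (z : Cn n) : 0 ≤ normD f z := Real.sqrt_nonneg _

lemma measurable_normD (f : Cn n → ℂ) : Measurable (normD f) := by
  unfold normD dz dzbar partialX partialY
  fun_prop

lemma finrank_Cn : Module.finrank ℝ (Cn n) = 2 * n := by
  rw [Module.finrank_eq_card_basis (realBasis n).toBasis]
  simp [mul_comm]

lemma integrable_normVol_iff {g : Cn n → ℝ} :
    Integrable g (normVol n) ↔ IntegrableOn g (unitBall n) := by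
  unfold normVol
  exact integrable_smul_measure (ENNReal.inv_ne_zero.2 measure_ball_lt_top.ne)
    (ENNReal.inv_ne_top.2 (measure_ball_pos volume _ one_pos).ne')

lemma MemDirichlet.integrableOn {γ α : ℝ} (hα : 0 < α) {f : Cn n → ℂ}
    (hf : MemDirichlet γ α f) :
    IntegrableOn (fun z => bdist z ^ γ * normD f z ^ α) (unitBall n) := by
  rw [← integrable_normVol_iff]
  have h1 : dirichletEnergy f γ 0 α < ∞ := by
    have h2 : dirichletEnergy f γ 0 α ^ (1 / α) < ∞ :=
      lt_of_le_of_lt (self_le_add_left _ _) hf.2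
    by_contra h
    rw [not_lt, top_le_iff] at h
    rw [h, ENNReal.top_rpow_of_pos (by positivity)] at h2
    exact lt_irrefl _ h2
  refine ⟨((continuous_bdist.measurable.pow_const γ).mul
    ((measurable_normD f).pow_const α)).aestronglyMeasurable, ?_⟩
  rw [hasFiniteIntegral_iff_ofReal (Eventually.of_forall fun z =>
    mul_nonneg (Real.rpow_nonneg (bdist_nonneg z) _) (Real.rpow_nonneg (normD_nonneg f z) _))]
  -- The factor `‖f z‖ ^ 0` is `1` even where `f` vanishes.
  simpa [dirichletEnergy] using h1

/-- Young's inequality in the form `x² ≤ K + K (x^α / K^(α/2))`. -/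
lemma sq_le_add_mul_rpow {x d s α : ℝ} (hx : 0 ≤ x) (hd : 0 < d) (hα : 2 ≤ α) :
    x ^ 2 ≤ d ^ (-(2 * s)) * (1 + d ^ (s * α) * x ^ α) := by
  -- For `y ≥ 0` and `α ≥ 2`, either `y ≤ 1` and `y² ≤ 1`, or `y ≥ 1` and `y² ≤ y^α`.
  have h1 : (d ^ s * x) ^ 2 ≤ 1 + (d ^ s * x) ^ α := by
    have hy : 0 ≤ d ^ s * x := by positivity
    rcases le_total (d ^ s * x) 1 with h | h
    · have := pow_le_one₀ (n := 2) hy h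
      have := Real.rpow_nonneg hy α
      linarith
    · have := Real.rpow_le_rpow_of_exponent_le h hα
      rw [Real.rpow_two] at this
      linarith
  rw [Real.mul_rpow (by positivity) hx, ← Real.rpow_mul hd.le] at h1
  have h2 : d ^ (-(2 * s)) * (d ^ s * x) ^ 2 = x ^ 2 := by
    rw [mul_pow, ← mul_assoc, ← Real.rpow_natCast (d ^ s), ← Real.rpow_mul hd.le,
      ← Real.rpow_add hd, show -(2 * s) + s * ((2 : ℕ) : ℝ) = 0 by push_cast; ring,
      Real.rpow_zero, one_mul]
  rw [← h2]
  exact mul_le_mul_of_nonneg_left h1 (by positivity)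

/-- Growth of the gradient of a function in the Dirichlet space whose squared gradient norm is
subharmonic. -/
lemma exists_normD_le (hn : 0 < n) {f : Cn n → ℂ} (hf : ContDiffOn ℝ 3 f (unitBall n))
    {γ α s : ℝ} (hγ : 0 < γ) (hα : 2 ≤ α) (hs : s * α = 2 * (n : ℝ) + γ)
    (hDir : MemDirichlet γ α f)
    (hgrad : ∀ z ∈ unitBall n, 0 ≤ (∑ k : Fin n,
      (conj (dz k f z) * dz k (Δ f) z + conj (dzbar k f z) * dzbar k (Δ f) z)).re) :
    ∃ C, 0 ≤ C ∧ ∀ z ∈ unitBall n, normD f z ≤ C * (1 - ‖z‖) ^ (-s) := by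
  have : Nonempty (Fin n) := ⟨⟨0, hn⟩⟩
  set w : Cn n → ℝ := fun z => bdist z ^ γ * normD f z ^ α with hw
  have hwi : IntegrableOn w (unitBall n) := hDir.integrableOn (by linarith)
  have hw0 : ∀ z, 0 ≤ w z := fun z =>
    mul_nonneg (Real.rpow_nonneg (bdist_nonneg z) _) (Real.rpow_nonneg (normD_nonneg f z) _)
  set I : ℝ := ∫ z in unitBall n, w z with hI
  have hI0 : 0 ≤ I := setIntegral_nonneg measurableSet_ball fun z _ => hw0 z
  set ρ : ℝ := ∫ y : Cn n, radialWeight y with hρ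
  have hρ0 : 0 < ρ := integral_radialWeight_pos
  set V : ℝ := volume.real (unitBall n) with hV
  -- The `4` is the bound on the radial weight, `4 ^ (2n)` comes from the radius `δ/4` in dimension
  -- `2n`, and `2 ^ γ` from `δ ≤ 2 d(x)` on that ball.
  set A : ℝ := 4 * (V + 4 ^ (2 * n) * 2 ^ γ * I) / ρ with hA
  have hA0 : 0 ≤ A := by positivity
  refine ⟨√A, Real.sqrt_nonneg _, fun z hz => ?_⟩
  have hz' : ‖z‖ < 1 := by simpa using hz
  set δ : ℝ := 1 - ‖z‖ with hδ
  have hδ0 : 0 < δ := by linarith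
  set K : ℝ := δ ^ (-(2 * s)) with hK
  have hK0 : 0 < K := by positivity
  have hnear : ∀ x ∈ ball z (δ / 4), ‖x‖ < 1 ∧ δ / 2 ≤ 1 - ‖x‖ := fun x hx => by
    have h1 : ‖x - z‖ < δ / 4 := by simpa [dist_eq_norm] using hx
    have h2 := norm_sub_norm_le x z
    constructor <;> linarith
  have hball : ball z (δ / 4) ⊆ unitBall n := fun x hx => by simpa using (hnear x hx).1
  have hmean := gradSq_mul_integral_le (realBasis n) isOpen_ball hf
    (fun x hx => by
      have := hgrad x hx
      rw [gradient_pairing] at this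
      linarith) (z := z) (r := δ / 4) (R := δ / 2) (by positivity) (by linarith)
    (fun x hx => by
      have h1 : ‖x - z‖ ≤ δ / 2 := by simpa [dist_eq_norm] using hx
      have h2 := norm_sub_norm_le x z
      have h3 : ‖x‖ < 1 := by linarith
      simpa using h3)
  have hg : ∀ x, gradSq (realBasis n) f x = 2 * normD f x ^ 2 := fun x => by
    rw [normD_sq]; ring
  simp only [hg, integral_const_mul, finrank_Cn] at hmean
  have hmean' : normD f z ^ 2 * ρ
      ≤ 4 * ((δ / 4) ^ (2 * n))⁻¹ * ∫ x in ball z (δ / 4), normD f x ^ 2 := by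
    rw [hρ]; linarith
  have hpt : ∀ x ∈ ball z (δ / 4), normD f x ^ 2 ≤ K + K * (δ ^ (2 * n) * 2 ^ γ) * w x := by
    intro x hx
    obtain ⟨hx1, hx2⟩ := hnear x hx
    have hxb : bdist x = 1 - ‖x‖ := bdist_eq hn (hball hx)
    -- Young's inequality is scaled by the fixed `δ`. Of `δ^(sα) = δ^(2n) δ^γ`, the first factor
    -- cancels the normalization of the mean and the second supplies the Dirichlet weight.
    have h1 := sq_le_add_mul_rpow (s := s) (normD_nonneg f x) hδ0 hα
    have h2 : δ ^ (s * α) ≤ δ ^ (2 * n) * 2 ^ γ * bdist x ^ γ := by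
      rw [hs, Real.rpow_add hδ0, mul_assoc, ← Real.mul_rpow zero_le_two (bdist_nonneg x),
        show 2 * (n : ℝ) = ((2 * n : ℕ) : ℝ) by push_cast; ring, Real.rpow_natCast]
      gcongr
      rw [hxb]; linarith
    have h3 : δ ^ (s * α) * normD f x ^ α ≤ δ ^ (2 * n) * 2 ^ γ * w x := by
      rw [hw, ← mul_assoc]
      exact mul_le_mul_of_nonneg_right h2 (Real.rpow_nonneg (normD_nonneg f x) _)
    calc normD f x ^ 2 ≤ K * (1 + δ ^ (s * α) * normD f x ^ α) := h1
      _ ≤ K * (1 + δ ^ (2 * n) * 2 ^ γ * w x) := by gcongr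
      _ = _ := by ring
  have hint : ∫ x in ball z (δ / 4), normD f x ^ 2
      ≤ K * ((δ / 4) ^ (2 * n) * V) + K * (δ ^ (2 * n) * 2 ^ γ) * I := by
    have hwz : IntegrableOn w (ball z (δ / 4)) := hwi.mono_set hball
    have hci : IntegrableOn (fun _ : Cn n => K) (ball z (δ / 4)) :=
      integrableOn_const measure_ball_lt_top.ne
    have hbd : IntegrableOn (fun x => K + K * (δ ^ (2 * n) * 2 ^ γ) * w x) (ball z (δ / 4)) :=
      hci.add (hwz.const_mul _)
    have hbd0 : ∀ x ∈ ball z (δ / 4), ‖normD f x ^ 2‖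
        ≤ K + K * (δ ^ (2 * n) * 2 ^ γ) * w x := fun x hx => by
      rw [Real.norm_of_nonneg (sq_nonneg _)]; exact hpt x hx
    have hD : IntegrableOn (fun x => normD f x ^ 2) (ball z (δ / 4)) :=
      hbd.mono' ((measurable_normD f).pow_const 2).aestronglyMeasurable
        ((ae_restrict_iff' measurableSet_ball).2 (Eventually.of_forall hbd0))
    refine (setIntegral_mono_on hD hbd measurableSet_ball hpt).trans ?_
    rw [integral_add hci (hwz.const_mul _), integral_const_mul, setIntegral_const, smul_eq_mul]
    refine add_le_add (le_of_eq ?_) ?_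
    · rw [measureReal_def, Measure.addHaar_ball_of_pos volume z (by positivity : 0 < δ / 4),
        ENNReal.toReal_mul, ENNReal.toReal_ofReal (by positivity), finrank_Cn, mul_comm K]
      rfl
    · refine mul_le_mul_of_nonneg_left ?_ (by positivity)
      exact setIntegral_mono_set hwi (Eventually.of_forall hw0) hball.eventuallyLE
  have hsq : normD f z ^ 2 ≤ A * K := by
    have h1 : normD f z ^ 2 * ρ ≤ 4 * K * (V + 4 ^ (2 * n) * 2 ^ γ * I) := by
      refine (hmean'.trans (mul_le_mul_of_nonneg_left hint (by positivity))).trans_eq ?_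
      rw [div_pow]
      field_simp
    rw [hA, div_mul_eq_mul_div, le_div_iff₀ hρ0]
    linarith
  calc normD f z ≤ √(A * K) := Real.le_sqrt_of_sq_le hsq
    _ = √A * δ ^ (-s) := by
      rw [Real.sqrt_mul hA0, hK, show -(2 * s) = -s + -s by ring, Real.rpow_add hδ0,
        Real.sqrt_mul_self (by positivity)]

/-- Integrating a gradient bound along radii. -/
lemma exists_norm_le_of_normD_le {f : Cn n → ℂ} (hf : DifferentiableOn ℝ f (unitBall n))
    {q C : ℝ} (hq : 0 < q) (hC : 0 ≤ C)
    (hD : ∀ z ∈ unitBall n, normD f z ≤ C * (1 - ‖z‖) ^ (-(q + 1))) :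
    ∃ C', 0 ≤ C' ∧ ∀ z ∈ unitBall n, ‖f z‖ ≤ C' * (1 - ‖z‖) ^ (-q) := by
  -- The factor `√2` is the ratio of the real gradient norm to `normD`.
  set A : ℝ := √2 * C with hA
  have hA0 : 0 ≤ A := by positivity
  refine ⟨‖f 0‖ + A / q, by positivity, fun z hz => ?_⟩
  have hz' : ‖z‖ < 1 := by simpa using hz
  have hmem : ∀ t ∈ Set.Icc (0 : ℝ) 1, t * ‖z‖ < 1 ∧ t • z ∈ unitBall n := fun t ht => by
    have h1 : t * ‖z‖ < 1 := by nlinarith [ht.1, ht.2, norm_nonneg z]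
    refine ⟨h1, ?_⟩
    simpa [norm_smul, abs_of_nonneg ht.1] using h1
  have hg : ∀ t ∈ Set.Icc (0 : ℝ) 1,
      HasDerivAt (fun t : ℝ => f (t • z)) (fderiv ℝ f (t • z) z) t := fun t ht => by
    have h1 : HasDerivAt (fun t : ℝ => t • z) z t := by
      simpa using (hasDerivAt_id t).smul_const z
    exact (hf.differentiableAt (isOpen_ball.mem_nhds (hmem t ht).2)).hasFDerivAt.comp_hasDerivAt
      t h1
  -- The barrier is the antiderivative of the gradient bound along the radius, equal at `t = 0` to
  -- `‖f 0‖ + A / q`.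
  have hB : ∀ t ∈ Set.Icc (0 : ℝ) 1,
      HasDerivAt (fun t : ℝ => ‖f 0‖ + A / q * (1 - t * ‖z‖) ^ (-q))
        (A * (1 - t * ‖z‖) ^ (-(q + 1)) * ‖z‖) t := fun t ht => by
    have h1 : HasDerivAt (fun t : ℝ => 1 - t * ‖z‖) (-‖z‖) t := by
      simpa using ((hasDerivAt_id t).mul_const ‖z‖).const_sub 1
    have h2 := ((h1.rpow_const (p := -q) (Or.inl (by linarith [(hmem t ht).1]))).const_mul
      (A / q)).const_add ‖f 0‖
    refine h2.congr_deriv ?_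
    rw [show -q - 1 = -(q + 1) by ring]
    field_simp
  have key := image_norm_le_of_norm_deriv_right_le_deriv_boundary'
    (f := fun t : ℝ => f (t • z)) (f' := fun t => fderiv ℝ f (t • z) z) (a := 0) (b := 1)
    (B := fun t : ℝ => ‖f 0‖ + A / q * (1 - t * ‖z‖) ^ (-q))
    (B' := fun t => A * (1 - t * ‖z‖) ^ (-(q + 1)) * ‖z‖)
    (fun t ht => (hg t ht).continuousAt.continuousWithinAt)
    (fun t ht => (hg t ⟨ht.1, ht.2.le⟩).hasDerivWithinAt)
    (by simp; positivity)
    (fun t ht => (hB t ht).continuousAt.continuousWithinAt)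
    (fun t ht => (hB t ⟨ht.1, ht.2.le⟩).hasDerivWithinAt)
    (fun t ht => by
      have ht' : t ∈ Set.Icc (0 : ℝ) 1 := ⟨ht.1, ht.2.le⟩
      refine (norm_fderiv_apply_le (realBasis n) f (t • z) z).trans ?_
      refine mul_le_mul_of_nonneg_right ?_ (norm_nonneg z)
      have h1 : gradSq (realBasis n) f (t • z) = 2 * normD f (t • z) ^ 2 := by
        rw [normD_sq]; ring
      rw [h1, Real.sqrt_mul zero_le_two, Real.sqrt_sq (normD_nonneg _ _), hA, mul_assoc]
      refine mul_le_mul_of_nonneg_left ((hD _ (hmem t ht').2).trans_eq ?_) (Real.sqrt_nonneg 2)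
      rw [norm_smul, Real.norm_of_nonneg ht.1])
    (Set.right_mem_Icc.2 zero_le_one)
  simp only [one_smul, one_mul] at key
  have h1 : 1 ≤ (1 - ‖z‖) ^ (-q) :=
    Real.one_le_rpow_of_pos_of_le_one_of_nonpos (by linarith) (by linarith [norm_nonneg z])
      (by linarith)
  nlinarith [norm_nonneg (f 0)]

end Growth


/-- Pointwise bound of `d^(pq) |Δ|f|^p|` in terms of `d^(2q) ‖D_f‖²`. -/
lemma rpow_mul_abs_laplacian_le {n : ℕ} {f : Cn n → ℂ} {z : Cn n} (hf : ContDiffAt ℝ 2 f z)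
    {d q p A B M C : ℝ} (hd : 0 < d) (hp : 2 ≤ p) (hA : 0 ≤ A) (hB : 0 ≤ B) (hC : 0 ≤ C)
    (hfz : ‖f z‖ ≤ C * d ^ (-q))
    (hΔ : ‖(Δ f) z‖ ≤ A * normD f z + B * ‖f z‖ + M * d ^ (-q)) :
    d ^ (p * q) * |(Δ fun w => ‖f w‖ ^ p) z|
      ≤ p * C ^ (p - 2) * ((2 * (p - 1) + C * A) * (d ^ q * normD f z) ^ 2
        + C * (A + B * C + M)) := by
  set D := normD f z with hDdef
  have hD : 0 ≤ D := normD_nonneg f z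
  have hdq : 0 < d ^ q := Real.rpow_pos_of_pos hd q
  have hdd : d ^ q * d ^ (-q) = 1 := by rw [← Real.rpow_add hd, add_neg_cancel, Real.rpow_zero]
  set F := d ^ q * ‖f z‖ with hF
  have hF0 : 0 ≤ F := by positivity
  have hFC : F ≤ C := by
    calc F ≤ d ^ q * (C * d ^ (-q)) := by rw [hF]; gcongr
      _ = C * (d ^ q * d ^ (-q)) := by ring
      _ = C := by rw [hdd, mul_one]
  have hL : d ^ q * ‖(Δ f) z‖ ≤ A * (1 + (d ^ q * D) ^ 2) + B * C + M := by
    have hY : d ^ q * D ≤ 1 + (d ^ q * D) ^ 2 := by nlinarith [sq_nonneg (d ^ q * D - 1)]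
    calc d ^ q * ‖(Δ f) z‖ ≤ d ^ q * (A * D + B * ‖f z‖ + M * d ^ (-q)) := by gcongr
      _ = A * (d ^ q * D) + B * F + M * (d ^ q * d ^ (-q)) := by rw [hF]; ring
      _ ≤ A * (1 + (d ^ q * D) ^ 2) + B * C + M := by
        rw [hdd, mul_one]; gcongr
  -- Of the `p` factors `d^q`, `p - 2` go to `|f|^(p-2)`; two remain for `‖D_f‖²` or for the product
  -- `|f| |Δf|`.
  have hsplit : d ^ (p * q) * ‖f z‖ ^ (p - 2) = (d ^ q) ^ 2 * F ^ (p - 2) := by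
    rw [hF, Real.mul_rpow hdq.le (norm_nonneg _), ← mul_assoc, ← Real.rpow_natCast (d ^ q) 2,
      ← Real.rpow_add hdq, ← Real.rpow_mul hd.le]
    congr 2; push_cast; ring
  have hFp : F ^ (p - 2) ≤ C ^ (p - 2) := Real.rpow_le_rpow hF0 hFC (by linarith)
  have hg : gradSq (realBasis n) f z = 2 * D ^ 2 := by rw [hDdef, normD_sq]; ring
  calc d ^ (p * q) * |(Δ fun w => ‖f w‖ ^ p) z|
      ≤ d ^ (p * q) * (p * ((p - 1) * ‖f z‖ ^ (p - 2) * (2 * D ^ 2)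
        + ‖f z‖ ^ (p - 2) * ‖f z‖ * ‖(Δ f) z‖)) := by
        rw [← hg]; gcongr; exact abs_laplacian_norm_rpow_le _ hf hp
    _ = p * (d ^ (p * q) * ‖f z‖ ^ (p - 2)) * (2 * (p - 1) * D ^ 2 + ‖f z‖ * ‖(Δ f) z‖) := by
        ring
    _ = p * F ^ (p - 2) * (2 * (p - 1) * (d ^ q * D) ^ 2 + F * (d ^ q * ‖(Δ f) z‖)) := by
        rw [hsplit, hF]; ring
    _ ≤ p * C ^ (p - 2) * (2 * (p - 1) * (d ^ q * D) ^ 2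
        + C * (A * (1 + (d ^ q * D) ^ 2) + B * C + M)) := by
        have : 0 ≤ p - 1 := by linarith
        gcongr
    _ = _ := by ring

end HeinzDirichlet

/-! ### Integrability of the weighted Laplacian. -/

open HeinzDirichlet in
theorem mainTheorem4 (n : ℕ) (f : HeinzDirichlet.Cn n → ℂ) (a b c : HeinzDirichlet.Cn n → ℝ)
    (M α γ q p : ℝ)
    (hM : 0 ≤ M) (hα : 2 ≤ α) (hαn : α ≤ 2 * (n : ℝ)) (hγ : 0 < γ)
    (hq : q = (2 * (n : ℝ) + γ) / α - 1) (hp : 2 ≤ p)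
    (hHeinz : HeinzDirichlet.MemHeinzWith 3 a b c f)
    (hDir : HeinzDirichlet.MemDirichlet γ α f)
    (hRe : ∀ z ∈ HeinzDirichlet.unitBall n, 0 ≤ (f z * conj ((Δ f) z)).re)
    (hGrad : ∀ z ∈ HeinzDirichlet.unitBall n,
      0 ≤ (∑ k : Fin n,
        (conj (HeinzDirichlet.dz k f z) * HeinzDirichlet.dz k (Δ f) z
          + conj (HeinzDirichlet.dzbar k f z) * HeinzDirichlet.dzbar k (Δ f) z)).re)
    (ha : BddAbove (a '' HeinzDirichlet.unitBall n))
    (hb : BddAbove (b '' HeinzDirichlet.unitBall n))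
    (hc : ∀ z ∈ HeinzDirichlet.unitBall n, c z ≤ M * HeinzDirichlet.bdist z ^ (-q)) :
    Integrable (fun z : HeinzDirichlet.Cn n =>
      HeinzDirichlet.bdist z ^ (p * q)
        * (Δ (fun w : HeinzDirichlet.Cn n => ‖f w‖ ^ p)) z)
      (HeinzDirichlet.normVol n) := by
  have hn : 0 < n := by
    have : (0 : ℝ) < n := by linarith
    exact_mod_cast this
  have hα0 : 0 < α := by linarith
  have hqα : (q + 1) * α = 2 * (n : ℝ) + γ := by rw [hq]; field_simp; ring
  -- Here `qα = 2n + γ - α ≥ γ > 0`; the same computation gives `γ/α ≤ q`.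
  have hq0 : 0 < q := by nlinarith
  have hγq : γ / α ≤ q := by rw [div_le_iff₀ hα0]; linarith
  have hf3 : ContDiffOn ℝ 3 f (unitBall n) := hHeinz.contDiffOn
  obtain ⟨C₀, hC₀, hD⟩ := exists_normD_le hn hf3 hγ hα hqα hDir hGrad
  obtain ⟨C, hC, hfC⟩ := exists_norm_le_of_normD_le (hf3.differentiableOn (by norm_num)) hq0 hC₀ hD
  obtain ⟨A, hA⟩ := ha
  obtain ⟨B, hB⟩ := hb
  have hA' : ∀ z ∈ unitBall n, a z ≤ A := fun z hz => hA (Set.mem_image_of_mem a hz)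
  have hB' : ∀ z ∈ unitBall n, b z ≤ B := fun z hz => hB (Set.mem_image_of_mem b hz)
  have h0 : (0 : Cn n) ∈ unitBall n := by simp
  have hA0 : 0 ≤ A := (hHeinz.nonneg_a 0 h0).trans (hA' 0 h0)
  have hB0 : 0 ≤ B := (hHeinz.nonneg_b 0 h0).trans (hB' 0 h0)
  have hw := hDir.integrableOn hα0
  rw [integrable_normVol_iff]
  have hconst : ∀ k : ℝ, IntegrableOn (fun _ : Cn n => k) (unitBall n) := fun k =>
    integrableOn_const measure_ball_lt_top.ne
  have hbound := ((((hconst 1).add hw).const_mul (2 * (p - 1) + C * A)).add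
    (hconst (C * (A + B * C + M)))).const_mul (p * C ^ (p - 2))
  refine hbound.mono' ((continuous_bdist.measurable.pow_const _).mul
    (measurable_laplacian _)).aestronglyMeasurable
    ((ae_restrict_iff' measurableSet_ball).2 (Filter.Eventually.of_forall fun z hz => ?_))
  have hz' : ‖z‖ < 1 := by simpa using hz
  have hd : bdist z = 1 - ‖z‖ := bdist_eq hn hz
  have hd0 : 0 < bdist z := by linarith
  have hd1 : bdist z ≤ 1 := by linarith [norm_nonneg z]
  rw [Real.norm_eq_abs, abs_mul, abs_of_nonneg (Real.rpow_nonneg hd0.le _)]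
  refine (rpow_mul_abs_laplacian_le (A := A) (B := B) (M := M) (C := C)
    ((hf3.contDiffAt (isOpen_ball.mem_nhds hz)).of_le (by norm_num))
    hd0 hp hA0 hB0 hC (by rw [hd]; exact hfC z hz) ?_).trans ?_
  · refine (hHeinz.heinz z hz).trans (add_le_add (add_le_add ?_ ?_) (hc z hz))
    · exact mul_le_mul_of_nonneg_right (hA' z hz) (normD_nonneg f z)
    · exact mul_le_mul_of_nonneg_right (hB' z hz) (norm_nonneg _)
  · have hY : (bdist z ^ q * normD f z) ^ 2 ≤ 1 + bdist z ^ γ * normD f z ^ α := by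
      have h1 := sq_le_add_mul_rpow (s := γ / α) (normD_nonneg f z) hd0 hα
      rw [div_mul_cancel₀ _ hα0.ne'] at h1
      -- The total exponent `2q - 2γ/α` is nonnegative and `d ≤ 1`.
      have h2 : (bdist z ^ q) ^ 2 * bdist z ^ (-(2 * (γ / α))) ≤ 1 := by
        rw [← Real.rpow_natCast (bdist z ^ q), ← Real.rpow_mul hd0.le, ← Real.rpow_add hd0]
        exact Real.rpow_le_one hd0.le hd1 (by push_cast; linarith)
      have h3 : 0 ≤ 1 + bdist z ^ γ * normD f z ^ α :=
        add_nonneg zero_le_one (mul_nonneg (Real.rpow_nonneg hd0.le _)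
          (Real.rpow_nonneg (normD_nonneg f z) _))
      calc (bdist z ^ q * normD f z) ^ 2 = (bdist z ^ q) ^ 2 * normD f z ^ 2 := mul_pow _ _ _
        _ ≤ (bdist z ^ q) ^ 2 * (bdist z ^ (-(2 * (γ / α)))
            * (1 + bdist z ^ γ * normD f z ^ α)) := by gcongr
        _ = (bdist z ^ q) ^ 2 * bdist z ^ (-(2 * (γ / α)))
            * (1 + bdist z ^ γ * normD f z ^ α) := by ring
        _ ≤ 1 + bdist z ^ γ * normD f z ^ α := mul_le_of_le_one_left h3 h2
    have hp1 : 0 ≤ 2 * (p - 1) + C * A := by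
      have := mul_nonneg hC hA0
      linarith
    exact mul_le_mul_of_nonneg_left (add_le_add_left (mul_le_mul_of_nonneg_left hY hp1) _)
      (mul_nonneg (by linarith) (Real.rpow_nonneg hC _))
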